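/- Let $T,\alpha,k,c,L>0$, $Y_0\in\mathbb{R}$ and $\gamma\in(0,1]$. Then there is a constant $C>0$, depending only on $T,\alpha,k,Y_0,c,L,\gamma$, such that the following holds. Let $\sigma:\mathbb{R}\to\mathbb{R}$ satisfy $\sigma(x)\ge c$ for all $x$ and the Hölder condition $$|\sigma^2(x)-\sigma^2(y)|\le L|x-y|^{\gamma}\qquad(x,y\in\mathbb{R}).$$ Let $Z=(Z_t)_{0\le t\le T}$ be a Wiener process on a probability space, and let $Y$ be the Ornstein–Uhlenbeck process solving $dY_t=-\alpha Y_t\,dt+k\,dZ_t$ on $[0,T]$ with deterministic initial value $Y_0$. For $m\ge1$ let $Y^{(m)}$ be the Euler–Maruyama scheme with step $T/m$: $$Y^{(m)}_0=Y_0,\qquad Y^{(m)}_{l+1}=\Bigl(1-\alpha\tfrac{T}{m}\Bigr)Y^{(m)}_l+k\bigl(Z_{(l+1)T/m}-Z_{lT/m}\bigr),\quad 0\le l\le m-1.$$ Put $$\bar\sigma=\sqrt{\frac1T\int_0^T\sigma^2(Y_s)\,ds},\qquad \bar\sigma_m=\sqrt{\frac1m\sum_{l=1}^m\sigma^2\bigl(Y^{(m)}_l\bigr)}.$$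 Then for every integer $m\ge1$ the random variable $|\bar\sigma-\bar\sigma_m|$ is integrable and $$\mathbb{E}|\bar\sigma-\bar\sigma_m|\le C\,m^{-\gamma/2}.$$ -/

import Mathlib

open MeasureTheory ProbabilityTheory

noncomputable section

/-- `Z` is a standard Wiener process on the time interval `[0, T]` under `P`
(only the values `Z t` with `t ∈ [0, T]` matter): it starts at `0`, has independent increments,
`Z t - Z s` is `N(0, t - s)` for `s ≤ t`, and almost every path is continuous. -/
structure IsWienerOn {Ω : Type*} [MeasurableSpace Ω] (T : ℝ) (Z : ℝ → Ω → ℝ)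
    (P : Measure Ω) : Prop where
  aemeasurable : ∀ t ∈ Set.Icc 0 T, AEMeasurable (Z t) P
  start : ∀ᵐ ω ∂P, Z 0 ω = 0
  indep_increments : ∀ (n : ℕ) (t : Fin (n + 1) → ℝ), Monotone t → (∀ i, t i ∈ Set.Icc 0 T) →
    iIndepFun (fun (i : Fin n) ω => Z (t i.succ) ω - Z (t i.castSucc) ω) P
  gaussian_increments : ∀ s ∈ Set.Icc 0 T, ∀ t ∈ Set.Icc 0 T, s ≤ t →
    HasLaw (fun ω => Z t ω - Z s ω) (gaussianReal 0 (t - s).toNNReal) P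
  continuous_paths : ∀ᵐ ω ∂P, ContinuousOn (fun t => Z t ω) (Set.Icc 0 T)

/-- `Y` is a (strong) solution on `[0, T]` of the Langevin equation
`dY_t = -α Y_t dt + k dZ_t` with deterministic initial value `y₀`. Since `k` is constant, the
stochastic integral `∫₀ᵗ k dZ_s` is `k (Z_t - Z_0)`. -/
structure IsLangevinSolution {Ω : Type*} [MeasurableSpace Ω] (T α k y₀ : ℝ)
    (Z Y : ℝ → Ω → ℝ) (P : Measure Ω) : Prop where
  aemeasurable : ∀ t ∈ Set.Icc 0 T, AEMeasurable (Y t) P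
  continuous_paths : ∀ᵐ ω ∂P, ContinuousOn (fun t => Y t ω) (Set.Icc 0 T)
  equation : ∀ᵐ ω ∂P, ∀ t ∈ Set.Icc 0 T,
    Y t ω = y₀ - α * (∫ s in (0 : ℝ)..t, Y s ω) + k * (Z t ω - Z 0 ω)

/-- The Euler-Maruyama chain `Y^{(m)}_l` for the Langevin equation, with `m` steps of length
`T / m`, driven by the path `z`. -/
def eulerLangevin (T α k y₀ : ℝ) (m : ℕ) (z : ℝ → ℝ) : ℕ → ℝ
  | 0 => y₀
  | l + 1 => (1 - α * (T / m)) * eulerLangevin T α k y₀ m z l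
      + k * (z (((l : ℝ) + 1) * T / m) - z ((l : ℝ) * T / m))

/-- The averaged volatility `√((1/T) ∫₀ᵀ σ²(y_s) ds)` along a path `y`. -/
def avgVolatility (T : ℝ) (σ : ℝ → ℝ) (y : ℝ → ℝ) : ℝ :=
  √((1 / T) * ∫ s in (0 : ℝ)..T, σ (y s) ^ 2)

/-- The discretized averaged volatility `√((1/m) ∑_{l=1}^m σ²(y_l))` along a sequence `y`. -/
def avgVolatilityDiscrete (m : ℕ) (σ : ℝ → ℝ) (y : ℕ → ℝ) : ℝ :=
  √((1 / (m : ℝ)) * ∑ l ∈ Finset.Icc 1 m, σ (y l) ^ 2)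

end

/-!
Since `σ ≥ c`, both averages of `σ ^ 2` are at least `c ^ 2`, where the square root is Lipschitz
with constant `1 / (2 c)`. Splitting `[0, T]` along the grid therefore reduces the claim to bounding
`|σ² (Y_s) - σ² (Y^{(m)}_{l+1})|` for `s` in the cell `[l T / m, (l + 1) T / m]`
(`abs_avgVolatility_sub_le`), and by the Hölder condition it is enough to show
`𝔼|Y_s - Y^{(m)}_{l+1}| ≤ D` with `D` of order `m ^ (-1 / 2)`. The passage from this to the `γ`-th
power is done on each path, by the tangent to `x ↦ x ^ γ` at `D`, so that only first moments occur.

For the first moments, Gaussianity gives `𝔼|Z_t - Z_s| ≤ √(t - s)`. An integrating factor bounds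
`|Y_t|` by the driving path up to time `t` (`abs_langevin_path_le`), hence `𝔼|Y_t|` is bounded, and
the equation gives `𝔼|Y_t - Y_s| = O(√(t - s))` (`l1Le_langevin_sub`). The error of the scheme at
the grid points satisfies a linear recursion with factor `1 + α T / m` driven by these increments,
and a discrete Grönwall argument (`l1Le_langevin_sub_euler`) bounds it by a multiple of `√(T / m)`
for every `m ≥ 1`.

Expectations and time integrals have to be interchanged, while `Z` and `Y` are only measurable for
each fixed time, up to null sets, with almost surely continuous paths. Both are therefore replaced by
indistinguishable processes that are jointly measurable (`exists_isContProcess_ae_eq`).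
-/

/-! ### Bounds in `L¹` -/

/-- `X` is bounded by `B` in `L¹(P)`: it is integrable and `𝔼|X| ≤ B`. -/
structure L1Le {Ω : Type*} [MeasurableSpace Ω] (P : Measure Ω) (X : Ω → ℝ) (B : ℝ) : Prop where
  integrable : Integrable X P
  bound : ∫ ω, |X ω| ∂P ≤ B

section L1

variable {Ω : Type*} [MeasurableSpace Ω] {P : Measure Ω} {X Y : Ω → ℝ} {A B : ℝ}

lemma L1Le.mono (h : L1Le P X A) (hAB : A ≤ B) : L1Le P X B :=
  ⟨h.integrable, h.bound.trans hAB⟩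

lemma L1Le.abs (h : L1Le P X A) : L1Le P (fun ω => |X ω|) A :=
  ⟨h.integrable.abs, by simpa using h.bound⟩

lemma L1Le.add (hX : L1Le P X A) (hY : L1Le P Y B) : L1Le P (fun ω => X ω + Y ω) (A + B) := by
  refine ⟨hX.integrable.add hY.integrable, ?_⟩
  calc ∫ ω, |X ω + Y ω| ∂P ≤ ∫ ω, (|X ω| + |Y ω|) ∂P :=
        integral_mono (hX.integrable.add hY.integrable).abs
          (hX.integrable.abs.add hY.integrable.abs) fun ω => abs_add_le _ _
    _ = ∫ ω, |X ω| ∂P + ∫ ω, |Y ω| ∂P := integral_add hX.integrable.abs hY.integrable.abs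
    _ ≤ A + B := add_le_add hX.bound hY.bound

lemma L1Le.const_mul (hX : L1Le P X A) {a : ℝ} (ha : 0 ≤ a) :
    L1Le P (fun ω => a * X ω) (a * A) := by
  refine ⟨hX.integrable.const_mul a, ?_⟩
  simp only [abs_mul, abs_of_nonneg ha, integral_const_mul]
  exact mul_le_mul_of_nonneg_left hX.bound ha

lemma L1Le.const [IsProbabilityMeasure P] (a : ℝ) : L1Le P (fun _ => a) |a| :=
  ⟨integrable_const a, by simp⟩

lemma L1Le.sum {ι : Type*} {s : Finset ι} {X : ι → Ω → ℝ} {A : ι → ℝ}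
    (h : ∀ i ∈ s, L1Le P (X i) (A i)) : L1Le P (fun ω => ∑ i ∈ s, X i ω) (∑ i ∈ s, A i) := by
  induction s using Finset.cons_induction with
  | empty => exact ⟨by simp, by simp⟩
  | cons a s ha ih =>
    simp only [Finset.sum_cons]
    exact (h a (by simp)).add (ih fun i hi => h i (by simp [hi]))

lemma L1Le.of_abs_le (hY : L1Le P Y B) (hX : AEStronglyMeasurable X P)
    (h : ∀ᵐ ω ∂P, |X ω| ≤ Y ω) : L1Le P X B := by
  have hi : Integrable X P := hY.integrable.mono' hX h
  refine ⟨hi, (integral_mono_ae hi.abs hY.integrable.abs ?_).trans hY.bound⟩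
  filter_upwards [h] with ω hω using hω.trans (le_abs_self _)

/-- `𝔼|X| ≤ √v` if `X` is `N(0, v)`-distributed, because the variance of `|X|` is nonnegative. -/
lemma ProbabilityTheory.HasLaw.l1Le_of_gaussianReal [IsProbabilityMeasure P] {v : NNReal}
    (h : HasLaw X (gaussianReal 0 v) P) : L1Le P X √v := by
  have h2 : MemLp X 2 P := h.hasGaussianLaw.memLp_two
  refine ⟨h2.integrable one_le_two, Real.le_sqrt_of_sq_le ?_⟩
  have hv : Var[X; P] = v := by rw [h.variance_eq, variance_id_gaussianReal]
  have hmean : P[X] = 0 := by rw [h.integral_eq, integral_id_gaussianReal]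
  have e1 := variance_eq_sub h2
  have e2 := variance_eq_sub h2.abs
  have e3 := variance_nonneg (|X|) P
  rw [hv, hmean] at e1
  simp only [Pi.pow_apply, Pi.abs_apply, sq_abs] at e1 e2
  linarith

end L1

/-! ### Processes with continuous paths -/

/-- A real process indexed by `ℝ` each of whose paths is continuous and each of whose
time marginals is measurable. -/
structure IsContProcess {Ω : Type*} [MeasurableSpace Ω] (X : ℝ → Ω → ℝ) : Prop where
  continuous : ∀ ω, Continuous fun t => X t ω
  measurable : ∀ t, Measurable (X t)

section ContProcess

variable {Ω : Type*} [MeasurableSpace Ω] {P : Measure Ω} {X Y : ℝ → Ω → ℝ}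

lemma IsContProcess.measurable_uncurry (hX : IsContProcess X) :
    Measurable (Function.uncurry X) :=
  measurable_uncurry_of_continuous_of_measurable hX.continuous hX.measurable

lemma IsContProcess.sub (hX : IsContProcess X) {Y : Ω → ℝ} (hY : Measurable Y) :
    IsContProcess fun t ω => X t ω - Y ω :=
  ⟨fun ω => (hX.continuous ω).sub continuous_const, fun t => (hX.measurable t).sub hY⟩

lemma IsContProcess.comp (hX : IsContProcess X) {f : ℝ → ℝ} (hf : Continuous f) :
    IsContProcess fun t ω => f (X t ω) :=
  ⟨fun ω => hf.comp (hX.continuous ω), fun t => hf.measurable.comp (hX.measurable t)⟩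

lemma IsContProcess.measurable_integral (hX : IsContProcess X) {a b : ℝ} (hab : a ≤ b) :
    Measurable fun ω => ∫ s in a..b, X s ω := by
  simp only [intervalIntegral.integral_of_le hab]
  exact (hX.measurable_uncurry.stronglyMeasurable.integral_prod_left'
    (μ := volume.restrict (Set.Ioc a b))).measurable

/-- Time integrals inherit `L¹` bounds, by Fubini's theorem. -/
lemma IsContProcess.l1Le_integral_abs [SFinite P] (hX : IsContProcess X) {a b B : ℝ}
    (hab : a ≤ b) (h : ∀ s ∈ Set.Icc a b, L1Le P (X s) B) :
    L1Le P (fun ω => ∫ s in a..b, |X s ω|) ((b - a) * B) := by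
  have hmeas := hX.measurable_uncurry
  have hmem : ∀ᵐ s ∂(volume.restrict (Set.Ioc a b)), L1Le P (X s) B := by
    filter_upwards [ae_restrict_mem measurableSet_Ioc] with s hs
    exact h s (Set.Ioc_subset_Icc_self hs)
  have hnorm : Integrable (fun s => ∫ ω, |X s ω| ∂P) (volume.restrict (Set.Ioc a b)) := by
    refine (integrable_const B).mono' ?_ ?_
    · exact (hmeas.abs.stronglyMeasurable.integral_prod_right' (ν := P)).aestronglyMeasurable
    · filter_upwards [hmem] with s hs
      rw [Real.norm_of_nonneg (integral_nonneg fun ω => abs_nonneg _)]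
      exact hs.bound
  have hint : Integrable (Function.uncurry fun s ω => |X s ω|)
      ((volume.restrict (Set.Ioc a b)).prod P) := by
    have habs : Measurable (Function.uncurry fun s ω => |X s ω|) := hmeas.abs
    rw [integrable_prod_iff habs.aestronglyMeasurable]
    refine ⟨?_, ?_⟩
    · filter_upwards [hmem] with s hs using hs.integrable.abs
    · simpa using hnorm
  simp only [intervalIntegral.integral_of_le hab]
  refine ⟨hint.integral_prod_right, ?_⟩
  have hpos : ∀ ω, |(∫ s in Set.Ioc a b, |X s ω|)| = ∫ s in Set.Ioc a b, |X s ω| := fun ω =>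
    abs_of_nonneg (integral_nonneg fun s => abs_nonneg _)
  simp only [hpos]
  rw [← integral_integral_swap hint]
  calc ∫ s in Set.Ioc a b, ∫ ω, |X s ω| ∂P ≤ ∫ _ in Set.Ioc a b, B :=
        integral_mono_ae hnorm (integrable_const B) (by
          filter_upwards [hmem] with s hs using hs.bound)
    _ = (b - a) * B := by simp [hab]

open Filter Topology in
/-- A process on `[0, T]` with almost surely continuous paths agrees, almost surely and
simultaneously for all times in `[0, T]`, with a process that is continuous and measurable without
exceptions. On the event that the path is continuous and that the values at countably many dense
times equal those of measurable representatives, all other values are measurable as limits. -/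
lemma exists_isContProcess_ae_eq {T : ℝ} (hT : 0 ≤ T)
    (hm : ∀ t ∈ Set.Icc 0 T, AEMeasurable (X t) P)
    (hc : ∀ᵐ ω ∂P, ContinuousOn (fun t => X t ω) (Set.Icc 0 T)) :
    ∃ X' : ℝ → Ω → ℝ, IsContProcess X' ∧ ∀ᵐ ω ∂P, ∀ t ∈ Set.Icc 0 T, X t ω = X' t ω := by
  classical
  let p : ℝ → ℝ := fun t => Set.projIcc 0 T hT t
  have hp : ∀ t, p t ∈ Set.Icc 0 T := fun t => (Set.projIcc 0 T hT t).2
  have hpc : Continuous p := continuous_subtype_val.comp continuous_projIcc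
  have hgood : ∀ᵐ ω ∂P, ContinuousOn (fun t => X t ω) (Set.Icc 0 T) ∧
      ∀ q : ℚ, X (p q) ω = (hm _ (hp q)).mk _ ω :=
    hc.and (ae_all_iff.2 fun q => (hm _ (hp q)).ae_eq_mk)
  obtain ⟨N, hN, hNm, hN0⟩ := exists_measurable_superset_of_null (ae_iff.1 hgood)
  have hG : ∀ ω, ω ∉ N → ContinuousOn (fun t => X t ω) (Set.Icc 0 T) ∧
      ∀ q : ℚ, X (p q) ω = (hm _ (hp q)).mk _ ω := fun ω hω => by
    by_contra hcon
    exact hω (hN hcon)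
  let X' : ℝ → Ω → ℝ := fun t ω => if ω ∈ N then 0 else X (p t) ω
  have hX'c : ∀ ω, Continuous fun t => X' t ω := fun ω => by
    by_cases hω : ω ∈ N
    · simpa [X', hω] using continuous_const
    · simp only [X', hω, if_false]
      exact (hG ω hω).1.comp_continuous hpc hp
  have hX'q : ∀ q : ℚ, Measurable (X' q) := fun q => by
    have : X' q = fun ω => if ω ∈ N then 0 else (hm _ (hp q)).mk _ ω := by
      funext ω
      by_cases hω : ω ∈ N
      · simp [X', hω]
      · simpa [X', hω] using (hG ω hω).2 q
    rw [this]
    exact Measurable.ite hNm measurable_const (hm _ (hp q)).measurable_mk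
  refine ⟨X', ⟨hX'c, fun t => ?_⟩, ?_⟩
  · choose q hq using fun n : ℕ =>
      exists_rat_btwn (show t - 1 / ((n : ℝ) + 1) < t from
        sub_lt_self t Nat.one_div_pos_of_nat)
    have hqt : Tendsto (fun n => (q n : ℝ)) atTop (𝓝 t) := by
      refine tendsto_of_tendsto_of_tendsto_of_le_of_le
        (by simpa using tendsto_const_nhds.sub (tendsto_one_div_add_atTop_nhds_zero_nat (𝕜 := ℝ)))
        tendsto_const_nhds (fun n => (hq n).1.le) fun n => (hq n).2.le
    exact measurable_of_tendsto_metrizable (fun n => hX'q (q n))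
      (tendsto_pi_nhds.2 fun ω => ((hX'c ω).tendsto t).comp hqt)
  · filter_upwards [measure_eq_zero_iff_ae_notMem.1 hN0] with ω hω t ht
    simp [X', hω, p, Set.projIcc_of_mem hT ht]

end ContProcess

/-! ### Pathwise estimates for the Langevin equation -/

section Pathwise

variable {T α k y₀ : ℝ} {y w : ℝ → ℝ}

/-- A path of the Ornstein–Uhlenbeck process is dominated by its driving path: with
`v = y - k w`, the function `s ↦ exp (α s) v s` has derivative `-α k exp (α s) w s`. -/
lemma abs_langevin_path_le (hα : 0 < α) (hk : 0 < k) (hy : Continuous y) (hw : Continuous w)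
    (heq : ∀ t ∈ Set.Icc 0 T, y t = y₀ - α * (∫ s in (0 : ℝ)..t, y s) + k * w t)
    {t : ℝ} (ht : t ∈ Set.Icc 0 T) :
    |y t| ≤ |y₀| + k * |w t| + α * k * ∫ s in (0 : ℝ)..t, |w s| := by
  set v : ℝ → ℝ := fun s => y₀ - α * ∫ u in (0 : ℝ)..s, y u with hv
  have hvd : ∀ s, HasDerivAt v (-(α * y s)) s := fun s => by
    simpa using ((hy.integral_hasStrictDerivAt 0 s).hasDerivAt.const_mul α).const_sub y₀
  have hFd : ∀ s ∈ Set.uIcc 0 t,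
      HasDerivAt (fun s => Real.exp (α * s) * v s) (-(α * k) * (Real.exp (α * s) * w s)) s := by
    intro s hs
    rw [Set.uIcc_of_le ht.1] at hs
    have he : HasDerivAt (fun s => Real.exp (α * s)) (Real.exp (α * s) * α) s := by
      simpa using ((hasDerivAt_id s).const_mul α).exp
    refine (he.mul (hvd s)).congr_deriv ?_
    have hys : y s = v s + k * w s := heq s ⟨hs.1, hs.2.trans ht.2⟩
    rw [hys]
    ring
  have hftc := intervalIntegral.integral_eq_sub_of_hasDerivAt hFd
    (by apply Continuous.intervalIntegrable; fun_prop)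
  have hv0 : v 0 = y₀ := by simp [hv]
  rw [intervalIntegral.integral_const_mul, mul_zero, Real.exp_zero, one_mul, hv0] at hftc
  have hbound : |∫ s in (0 : ℝ)..t, Real.exp (α * s) * w s| ≤
      Real.exp (α * t) * ∫ s in (0 : ℝ)..t, |w s| := by
    rw [← intervalIntegral.integral_const_mul]
    refine (intervalIntegral.abs_integral_le_integral_abs ht.1).trans ?_
    refine intervalIntegral.integral_mono_on ht.1
      (by apply Continuous.intervalIntegrable; fun_prop)
      (by apply Continuous.intervalIntegrable; fun_prop) fun s hs => ?_
    rw [abs_mul, abs_of_pos (Real.exp_pos _)]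
    gcongr
    exact hs.2
  have hE : 1 ≤ Real.exp (α * t) := Real.one_le_exp (mul_nonneg hα.le ht.1)
  have hvt : |v t| ≤ |y₀| + α * k * ∫ s in (0 : ℝ)..t, |w s| := by
    have h1 : Real.exp (α * t) * |v t| ≤
        Real.exp (α * t) * (|y₀| + α * k * ∫ s in (0 : ℝ)..t, |w s|) := by
      calc Real.exp (α * t) * |v t| = |Real.exp (α * t) * v t| := by
            rw [abs_mul, abs_of_pos (Real.exp_pos _)]
        _ = |y₀ + -(α * k) * ∫ s in (0 : ℝ)..t, Real.exp (α * s) * w s| := by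
            congr 1; linarith
        _ ≤ |y₀| + α * k * |∫ s in (0 : ℝ)..t, Real.exp (α * s) * w s| := by
            refine (abs_add_le _ _).trans_eq ?_
            rw [abs_mul, abs_neg, abs_of_pos (mul_pos hα hk)]
        _ ≤ Real.exp (α * t) * |y₀| +
            α * k * (Real.exp (α * t) * ∫ s in (0 : ℝ)..t, |w s|) := by
            refine add_le_add (le_mul_of_one_le_left (abs_nonneg _) hE) ?_
            exact mul_le_mul_of_nonneg_left hbound (mul_pos hα hk).le
        _ = _ := by ring
    exact le_of_mul_le_mul_left h1 (Real.exp_pos _)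
  calc |y t| = |v t + k * w t| := by rw [heq t ht]
    _ ≤ |v t| + k * |w t| := by
        refine (abs_add_le _ _).trans_eq ?_
        rw [abs_mul, abs_of_pos hk]
    _ ≤ _ := by linarith

lemma langevin_path_sub_eq (hy : Continuous y)
    (heq : ∀ t ∈ Set.Icc 0 T, y t = y₀ - α * (∫ s in (0 : ℝ)..t, y s) + k * w t)
    {s t : ℝ} (hs : s ∈ Set.Icc 0 T) (ht : t ∈ Set.Icc 0 T) :
    y t - y s = k * (w t - w s) - α * ∫ u in s..t, y u := by
  have h := intervalIntegral.integral_add_adjacent_intervals (μ := volume)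
    (hy.intervalIntegrable 0 s) (hy.intervalIntegrable s t)
  rw [heq t ht, heq s hs, ← h]
  ring

lemma abs_langevin_path_sub_le (hα : 0 < α) (hk : 0 < k) (hy : Continuous y)
    (heq : ∀ t ∈ Set.Icc 0 T, y t = y₀ - α * (∫ s in (0 : ℝ)..t, y s) + k * w t)
    {s t : ℝ} (hs : s ∈ Set.Icc 0 T) (ht : t ∈ Set.Icc 0 T) (hst : s ≤ t) :
    |y t - y s| ≤ k * |w t - w s| + α * ∫ u in s..t, |y u| := by
  rw [langevin_path_sub_eq hy heq hs ht]
  refine (abs_sub _ _).trans ?_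
  rw [abs_mul, abs_mul, abs_of_pos hα, abs_of_pos hk]
  gcongr
  exact intervalIntegral.abs_integral_le_integral_abs hst

lemma grid_mem_Icc (hT : 0 ≤ T) {l m : ℕ} (hl : l ≤ m) : (l : ℝ) * T / m ∈ Set.Icc 0 T := by
  refine ⟨by positivity, ?_⟩
  rcases Nat.eq_zero_or_pos m with rfl | hm
  · simpa using hT
  · rw [div_le_iff₀ (by exact_mod_cast hm), mul_comm T]
    gcongr

/-- The scheme only sees the increments of the driving path on `[0, T]`. -/
lemma eulerLangevin_congr (hT : 0 ≤ T) {z : ℝ → ℝ} {m : ℕ}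
    (h : ∀ s ∈ Set.Icc 0 T, ∀ t ∈ Set.Icc 0 T, z t - z s = w t - w s) {l : ℕ} (hl : l ≤ m) :
    eulerLangevin T α k y₀ m z l = eulerLangevin T α k y₀ m w l := by
  induction l with
  | zero => rfl
  | succ l ih =>
    have h1 := grid_mem_Icc hT hl
    rw [Nat.cast_succ] at h1
    rw [eulerLangevin, eulerLangevin, ih (by omega), h _ (grid_mem_Icc hT (by omega : l ≤ m)) _ h1]

/-- One step of the error recursion. The crude factor `1 + α T / m` in place of `|1 - α T / m|`
makes the estimate valid also for coarse grids. -/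
lemma abs_langevin_sub_euler_succ_le (hT : 0 ≤ T) (hα : 0 < α) (hy : Continuous y)
    (heq : ∀ t ∈ Set.Icc 0 T, y t = y₀ - α * (∫ s in (0 : ℝ)..t, y s) + k * w t)
    {l m : ℕ} (hl : l < m) :
    |y (((l : ℝ) + 1) * T / m) - eulerLangevin T α k y₀ m w (l + 1)| ≤
      (1 + α * (T / m)) * |y ((l : ℝ) * T / m) - eulerLangevin T α k y₀ m w l| +
      α * ∫ s in ((l : ℝ) * T / m)..(((l : ℝ) + 1) * T / m), |y s - y ((l : ℝ) * T / m)| := by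
  have h0 := grid_mem_Icc hT hl.le
  have h1 := grid_mem_Icc hT (Nat.succ_le_of_lt hl)
  rw [Nat.cast_succ] at h1
  have hlen : ((l : ℝ) + 1) * T / m - (l : ℝ) * T / m = T / m := by ring
  have hh : 0 ≤ T / m := by positivity
  have hinc := langevin_path_sub_eq hy heq h0 h1
  rw [eulerLangevin]
  set a := (l : ℝ) * T / m
  set b := ((l : ℝ) + 1) * T / m
  set e := eulerLangevin T α k y₀ m w l
  have hab : a ≤ b := by linarith
  have hsub : ∫ s in a..b, (y s - y a) = (∫ s in a..b, y s) - T / m * y a := by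
    rw [intervalIntegral.integral_sub (hy.intervalIntegrable a b) intervalIntegrable_const,
      intervalIntegral.integral_const, hlen, smul_eq_mul]
  have hid : y b - ((1 - α * (T / m)) * e + k * (w b - w a)) =
      (1 - α * (T / m)) * (y a - e) - α * ∫ s in a..b, (y s - y a) := by
    rw [hsub]
    linear_combination hinc
  rw [hid]
  refine (abs_sub _ _).trans ?_
  rw [abs_mul, abs_mul, abs_of_pos hα]
  have hαh : 0 ≤ α * (T / m) := by positivity
  gcongr
  · exact abs_le.2 ⟨by linarith, by linarith⟩
  · exact intervalIntegral.abs_integral_le_integral_abs hab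

end Pathwise

/-! ### Comparison of the averaged volatilities along a path -/

section Volatility

lemma continuous_of_abs_sub_le_rpow {f : ℝ → ℝ} {L γ : ℝ} (hγ : 0 < γ)
    (h : ∀ x y, |f x - f y| ≤ L * |x - y| ^ γ) : Continuous f := by
  refine continuous_iff_continuousAt.2 fun x => tendsto_iff_norm_sub_tendsto_zero.2 ?_
  refine squeeze_zero (fun _ => norm_nonneg _) (fun y => h y x) ?_
  have hc : Continuous fun y : ℝ => L * |y - x| ^ γ :=
    continuous_const.mul ((continuous_abs.comp (continuous_id.sub continuous_const)).rpow_const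
      fun _ => Or.inr hγ.le)
  simpa [Real.zero_rpow hγ.ne'] using hc.tendsto x

/-- The concave function `x ↦ x ^ γ` lies below its tangent at `D`. -/
lemma rpow_le_tangent {x D γ : ℝ} (hx : 0 ≤ x) (hD : 0 < D) (hγ₀ : 0 ≤ γ) (hγ₁ : γ ≤ 1) :
    x ^ γ ≤ D ^ γ * γ / D * x + D ^ γ * (1 - γ) := by
  have h := Real.geom_mean_le_arith_mean2_weighted hγ₀ (sub_nonneg.2 hγ₁)
    (div_nonneg hx hD.le) zero_le_one (by ring)
  rw [Real.one_rpow, mul_one, mul_one, Real.div_rpow hx hD.le,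
    div_le_iff₀ (Real.rpow_pos_of_pos hD γ)] at h
  refine h.trans_eq ?_
  ring

lemma abs_sqrt_sub_sqrt_le {a b c : ℝ} (hc : 0 < c) (ha : c ^ 2 ≤ a) (hb : c ^ 2 ≤ b) :
    |√a - √b| ≤ (2 * c)⁻¹ * |a - b| := by
  have hsa : c ≤ √a := Real.le_sqrt_of_sq_le ha
  have hsb : c ≤ √b := Real.le_sqrt_of_sq_le hb
  have hfac : a - b = (√a + √b) * (√a - √b) := by
    have h1 := Real.sq_sqrt ((sq_nonneg c).trans ha)
    have h2 := Real.sq_sqrt ((sq_nonneg c).trans hb)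
    linear_combination -h1 + h2
  rw [hfac, abs_mul, abs_of_pos (by linarith : 0 < √a + √b), inv_mul_eq_div,
    le_div_iff₀ (by positivity), mul_comm]
  gcongr
  linarith

/-- Both averages are split along the grid; the square root is Lipschitz on `[c ^ 2, ∞)`. -/
lemma abs_avgVolatility_sub_le {T c : ℝ} {σ y : ℝ → ℝ} {e : ℕ → ℝ} {m : ℕ} (hT : 0 < T)
    (hc : 0 < c) (hm : 1 ≤ m) (hσ : ∀ x, c ≤ σ x) (hσc : Continuous fun x => σ x ^ 2)
    (hy : Continuous y) :
    |avgVolatility T σ y - avgVolatilityDiscrete m σ e| ≤ (2 * c * T)⁻¹ *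
      ∑ l ∈ Finset.range m, ∫ s in ((l : ℝ) * T / m)..(((l : ℝ) + 1) * T / m),
        |σ (y s) ^ 2 - σ (e (l + 1)) ^ 2| := by
  have hm0 : (0 : ℝ) < m := by exact_mod_cast hm
  have hfy : Continuous fun s => σ (y s) ^ 2 := hσc.comp hy
  have hσ2 : ∀ x, c ^ 2 ≤ σ x ^ 2 := fun x => pow_le_pow_left₀ hc.le (hσ x) 2
  have hlow : c ^ 2 ≤ 1 / T * ∫ s in (0 : ℝ)..T, σ (y s) ^ 2 := by
    have h : ∫ _ in (0 : ℝ)..T, c ^ 2 ≤ ∫ s in (0 : ℝ)..T, σ (y s) ^ 2 :=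
      intervalIntegral.integral_mono_on hT.le intervalIntegrable_const
        (hfy.intervalIntegrable _ _) fun s _ => hσ2 _
    rw [intervalIntegral.integral_const, sub_zero, smul_eq_mul] at h
    rw [one_div, inv_mul_eq_div, le_div_iff₀ hT]
    linarith
  have hlow' : c ^ 2 ≤ 1 / (m : ℝ) * ∑ l ∈ Finset.Icc 1 m, σ (e l) ^ 2 := by
    have h := Finset.card_nsmul_le_sum (Finset.Icc 1 m) (fun l => σ (e l) ^ 2) (c ^ 2)
      fun l _ => hσ2 _
    rw [Nat.card_Icc, Nat.add_sub_cancel, nsmul_eq_mul] at h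
    rw [one_div, inv_mul_eq_div, le_div_iff₀ hm0]
    linarith
  have hsplit : ∑ l ∈ Finset.range m, ∫ s in ((l : ℝ) * T / m)..(((l : ℝ) + 1) * T / m),
      σ (y s) ^ 2 = ∫ s in (0 : ℝ)..T, σ (y s) ^ 2 := by
    have h := intervalIntegral.sum_integral_adjacent_intervals (μ := volume)
      (a := fun l : ℕ => (l : ℝ) * T / m) (n := m) (f := fun s => σ (y s) ^ 2)
      fun l _ => hfy.intervalIntegrable _ _
    simpa [Nat.cast_succ, mul_div_assoc, mul_div_cancel₀, hm0.ne', mul_comm (m : ℝ)] using h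
  have hdiff : (1 / T * ∫ s in (0 : ℝ)..T, σ (y s) ^ 2) -
      1 / (m : ℝ) * ∑ l ∈ Finset.Icc 1 m, σ (e l) ^ 2 =
      T⁻¹ * ∑ l ∈ Finset.range m, ∫ s in ((l : ℝ) * T / m)..(((l : ℝ) + 1) * T / m),
        (σ (y s) ^ 2 - σ (e (l + 1)) ^ 2) := by
    have hIcc : ∑ l ∈ Finset.Icc 1 m, σ (e l) ^ 2 =
        ∑ l ∈ Finset.range m, σ (e (l + 1)) ^ 2 := by
      rw [Finset.range_eq_Ico, Finset.sum_Ico_add' (fun l => σ (e l) ^ 2) 0 m 1]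
      rfl
    have hterm : ∀ l : ℕ, ∫ s in ((l : ℝ) * T / m)..(((l : ℝ) + 1) * T / m),
        (σ (y s) ^ 2 - σ (e (l + 1)) ^ 2) =
        (∫ s in ((l : ℝ) * T / m)..(((l : ℝ) + 1) * T / m), σ (y s) ^ 2) -
          T / m * σ (e (l + 1)) ^ 2 := fun l => by
      rw [intervalIntegral.integral_sub (hfy.intervalIntegrable _ _) intervalIntegrable_const,
        intervalIntegral.integral_const, smul_eq_mul]
      ring
    simp only [hterm, Finset.sum_sub_distrib, hsplit, ← Finset.mul_sum, hIcc]
    field_simp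
  refine (abs_sqrt_sub_sqrt_le hc hlow hlow').trans ?_
  rw [hdiff, abs_mul, abs_of_pos (inv_pos.2 hT), mul_inv (2 * c), mul_assoc]
  gcongr
  refine (Finset.abs_sum_le_sum_abs _ _).trans (Finset.sum_le_sum fun l _ => ?_)
  refine intervalIntegral.abs_integral_le_integral_abs ?_
  gcongr
  linarith

/-- The Hölder condition enters through the tangent of `x ↦ x ^ γ` at `D`, which bounds the
difference of the volatilities by an affine function of the distances of the paths. -/
lemma abs_avgVolatility_sub_le_affine {T c L γ D : ℝ} {σ y : ℝ → ℝ} {e : ℕ → ℝ} {m : ℕ}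
    (hT : 0 < T) (hc : 0 < c) (hL : 0 < L) (hγ₀ : 0 < γ) (hγ₁ : γ ≤ 1) (hD : 0 < D)
    (hm : 1 ≤ m) (hσ : ∀ x, c ≤ σ x) (hH : ∀ x y, |σ x ^ 2 - σ y ^ 2| ≤ L * |x - y| ^ γ)
    (hy : Continuous y) :
    |avgVolatility T σ y - avgVolatilityDiscrete m σ e| ≤ (2 * c * T)⁻¹ *
      ∑ l ∈ Finset.range m, (L * (D ^ γ * γ / D) *
        (∫ s in ((l : ℝ) * T / m)..(((l : ℝ) + 1) * T / m), |y s - e (l + 1)|) +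
          L * (D ^ γ * (1 - γ)) * (T / m)) := by
  have hσc : Continuous fun x => σ x ^ 2 := continuous_of_abs_sub_le_rpow hγ₀ hH
  refine (abs_avgVolatility_sub_le hT hc hm hσ hσc hy).trans ?_
  refine mul_le_mul_of_nonneg_left (Finset.sum_le_sum fun l _ => ?_) (by positivity)
  have hlen : ((l : ℝ) + 1) * T / m - (l : ℝ) * T / m = T / m := by ring
  have hh : 0 ≤ T / m := by positivity
  set a := (l : ℝ) * T / m
  set b := ((l : ℝ) + 1) * T / m
  have hint : IntervalIntegrable (fun s => L * (D ^ γ * γ / D) * |y s - e (l + 1)|) volume a b := by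
    apply Continuous.intervalIntegrable; fun_prop
  calc ∫ s in a..b, |σ (y s) ^ 2 - σ (e (l + 1)) ^ 2|
      ≤ ∫ s in a..b, (L * (D ^ γ * γ / D) * |y s - e (l + 1)| + L * (D ^ γ * (1 - γ))) := by
        refine intervalIntegral.integral_mono_on (by linarith) ?_
          (hint.add intervalIntegrable_const) fun s _ => (hH _ _).trans ?_
        · exact (((hσc.comp hy).sub continuous_const).abs).intervalIntegrable _ _
        · have h := mul_le_mul_of_nonneg_left
            (rpow_le_tangent (abs_nonneg (y s - e (l + 1))) hD hγ₀.le hγ₁) hL.le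
          linarith
    _ = _ := by
        rw [intervalIntegral.integral_add hint intervalIntegrable_const,
          intervalIntegral.integral_const_mul, intervalIntegral.integral_const, hlen, smul_eq_mul]
        ring

end Volatility

/-! ### First moments of the process and of the scheme error -/

section Moments

variable {Ω : Type*} [MeasurableSpace Ω] {P : Measure Ω} {T α k y₀ : ℝ} {Y W : ℝ → Ω → ℝ}

/-- A bound for `𝔼|Y_t|`, uniform over `t ∈ [0, T]`, of the Ornstein–Uhlenbeck process. -/
noncomputable def langevinL1Bound (T α k y₀ : ℝ) : ℝ := |y₀| + k * √T + α * k * (T * √T)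

/-- A constant `K` for which `𝔼|Y_t - Y_s| ≤ K √h` whenever `0 ≤ t - s ≤ h ≤ T`. -/
noncomputable def langevinIncrementConst (T α k y₀ : ℝ) : ℝ :=
  k + α * (√T * langevinL1Bound T α k y₀)

lemma langevinL1Bound_nonneg (hT : 0 ≤ T) (hα : 0 < α) (hk : 0 < k) :
    0 ≤ langevinL1Bound T α k y₀ := by
  unfold langevinL1Bound
  positivity

lemma langevinIncrementConst_pos (hT : 0 ≤ T) (hα : 0 < α) (hk : 0 < k) :
    0 < langevinIncrementConst T α k y₀ := by
  have := langevinL1Bound_nonneg (y₀ := y₀) hT hα hk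
  unfold langevinIncrementConst
  positivity

lemma l1Le_langevin [IsProbabilityMeasure P] (hα : 0 < α) (hk : 0 < k)
    (hY : IsContProcess Y) (hW : IsContProcess W)
    (hWb : ∀ t ∈ Set.Icc 0 T, L1Le P (W t) √T)
    (heq : ∀ᵐ ω ∂P, ∀ t ∈ Set.Icc 0 T,
      Y t ω = y₀ - α * (∫ s in (0 : ℝ)..t, Y s ω) + k * W t ω)
    {t : ℝ} (ht : t ∈ Set.Icc 0 T) : L1Le P (Y t) (langevinL1Bound T α k y₀) := by
  have hint := hW.l1Le_integral_abs (P := P) ht.1 fun s hs => hWb s ⟨hs.1, hs.2.trans ht.2⟩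
  have hsum := ((L1Le.const (P := P) |y₀|).add ((hWb t ht).abs.const_mul hk.le)).add
    (hint.const_mul (mul_pos hα hk).le)
  refine (hsum.of_abs_le (hY.measurable t).aestronglyMeasurable ?_).mono ?_
  · filter_upwards [heq] with ω hω
    exact abs_langevin_path_le hα hk (hY.continuous ω) (hW.continuous ω) hω ht
  · rw [abs_abs, langevinL1Bound, sub_zero]
    gcongr
    exact ht.2

lemma l1Le_langevin_sub [IsProbabilityMeasure P] (hT : 0 ≤ T) (hα : 0 < α) (hk : 0 < k)
    (hY : IsContProcess Y) (hW : IsContProcess W) (hW0 : ∀ ω, W 0 ω = 0)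
    (hinc : ∀ s ∈ Set.Icc 0 T, ∀ t ∈ Set.Icc 0 T, s ≤ t →
      L1Le P (fun ω => W t ω - W s ω) √(t - s))
    (heq : ∀ᵐ ω ∂P, ∀ t ∈ Set.Icc 0 T,
      Y t ω = y₀ - α * (∫ s in (0 : ℝ)..t, Y s ω) + k * W t ω)
    {s t h : ℝ} (hs : s ∈ Set.Icc 0 T) (ht : t ∈ Set.Icc 0 T) (hst : s ≤ t) (hh : t - s ≤ h)
    (hhT : h ≤ T) :
    L1Le P (fun ω => Y t ω - Y s ω) (langevinIncrementConst T α k y₀ * √h) := by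
  have hWb : ∀ u ∈ Set.Icc 0 T, L1Le P (W u) √T := fun u hu => by
    have h0 := hinc 0 ⟨le_rfl, hT⟩ u hu hu.1
    simp only [hW0, sub_zero] at h0
    exact h0.mono (Real.sqrt_le_sqrt hu.2)
  have hint := hY.l1Le_integral_abs (P := P) hst fun u hu =>
    l1Le_langevin hα hk hY hW hWb heq (t := u) ⟨hs.1.trans hu.1, hu.2.trans ht.2⟩
  have hsum := ((hinc s hs t ht hst).abs.const_mul hk.le).add (hint.const_mul hα.le)
  refine (hsum.of_abs_le ((hY.measurable t).sub (hY.measurable s)).aestronglyMeasurable ?_).mono ?_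
  · filter_upwards [heq] with ω hω
    exact abs_langevin_path_sub_le hα hk (hY.continuous ω) hω hs ht hst
  · have h0 : 0 ≤ h := by linarith
    have hM := langevinL1Bound_nonneg (y₀ := y₀) hT hα hk
    have hts : t - s ≤ √T * √h := by
      calc t - s ≤ √h * √h := by rwa [Real.mul_self_sqrt h0]
        _ ≤ √T * √h := by gcongr
    calc k * √(t - s) + α * ((t - s) * langevinL1Bound T α k y₀)
        ≤ k * √h + α * ((√T * √h) * langevinL1Bound T α k y₀) := by gcongr
      _ = langevinIncrementConst T α k y₀ * √h := by
          rw [langevinIncrementConst]; ring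

lemma measurable_eulerLangevin (hW : IsContProcess W) (m l : ℕ) :
    Measurable fun ω => eulerLangevin T α k y₀ m (fun t => W t ω) l := by
  induction l with
  | zero => exact measurable_const
  | succ l ih =>
    exact (ih.const_mul _).add (((hW.measurable _).sub (hW.measurable _)).const_mul k)

/-- The Euler scheme has strong order `1 / 2` at the grid points. The bound
`K √(T / m) ((1 + α T / m) ^ l - 1)` solves the error recursion with equality. -/
lemma l1Le_langevin_sub_euler [IsProbabilityMeasure P] (hT : 0 ≤ T) (hα : 0 < α) (hk : 0 < k)
    (hY : IsContProcess Y) (hW : IsContProcess W) (hW0 : ∀ ω, W 0 ω = 0)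
    (hinc : ∀ s ∈ Set.Icc 0 T, ∀ t ∈ Set.Icc 0 T, s ≤ t →
      L1Le P (fun ω => W t ω - W s ω) √(t - s))
    (heq : ∀ᵐ ω ∂P, ∀ t ∈ Set.Icc 0 T,
      Y t ω = y₀ - α * (∫ s in (0 : ℝ)..t, Y s ω) + k * W t ω)
    {m : ℕ} (hm : 1 ≤ m) {l : ℕ} (hl : l ≤ m) :
    L1Le P (fun ω => Y ((l : ℝ) * T / m) ω - eulerLangevin T α k y₀ m (fun t => W t ω) l)
      (langevinIncrementConst T α k y₀ * √(T / m) * ((1 + α * (T / m)) ^ l - 1)) := by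
  induction l with
  | zero =>
    refine ((L1Le.const (P := P) 0).of_abs_le ?_ ?_).mono (by simp)
    · exact ((hY.measurable _).sub (measurable_eulerLangevin hW m 0)).aestronglyMeasurable
    · filter_upwards [heq] with ω hω
      have h0 := hω 0 ⟨le_rfl, hT⟩
      simp only [intervalIntegral.integral_same, mul_zero, sub_zero, hW0, add_zero] at h0
      simp [eulerLangevin, h0]
  | succ l ih =>
    have hlm : l < m := hl
    have h0 := grid_mem_Icc hT hlm.le
    have h1 := grid_mem_Icc hT hl
    have hh : 0 ≤ T / m := by positivity
    have hhT : T / m ≤ T := div_le_self hT (by exact_mod_cast hm)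
    have hlen : ((l : ℝ) + 1) * T / m - (l : ℝ) * T / m = T / m := by ring
    rw [Nat.cast_succ] at h1 ⊢
    have hab : (l : ℝ) * T / m ≤ ((l : ℝ) + 1) * T / m := by linarith
    have hint := (hY.sub (hY.measurable ((l : ℝ) * T / m))).l1Le_integral_abs (P := P) hab
      fun s hs => l1Le_langevin_sub hT hα hk hY hW hW0 hinc heq h0
        ⟨h0.1.trans hs.1, hs.2.trans h1.2⟩ hs.1 (h := T / m) (by linarith [hs.2]) hhT
    have hsum := ((ih hlm.le).abs.const_mul (by positivity : 0 ≤ 1 + α * (T / m))).add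
      (hint.const_mul hα.le)
    refine (hsum.of_abs_le ?_ ?_).mono (le_of_eq ?_)
    · exact ((hY.measurable _).sub (measurable_eulerLangevin hW m (l + 1))).aestronglyMeasurable
    · filter_upwards [heq] with ω hω
      exact abs_langevin_sub_euler_succ_le hT hα (hY.continuous ω) hω hlm
    · rw [hlen]
      ring

/-- On the grid cell `[l T / m, (l + 1) T / m]` the process is close to the scheme at the right
end point. -/
lemma l1Le_langevin_sub_euler_cell [IsProbabilityMeasure P] (hT : 0 ≤ T) (hα : 0 < α) (hk : 0 < k)
    (hY : IsContProcess Y) (hW : IsContProcess W) (hW0 : ∀ ω, W 0 ω = 0)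
    (hinc : ∀ s ∈ Set.Icc 0 T, ∀ t ∈ Set.Icc 0 T, s ≤ t →
      L1Le P (fun ω => W t ω - W s ω) √(t - s))
    (heq : ∀ᵐ ω ∂P, ∀ t ∈ Set.Icc 0 T,
      Y t ω = y₀ - α * (∫ s in (0 : ℝ)..t, Y s ω) + k * W t ω)
    {m l : ℕ} (hl : l < m) {s : ℝ}
    (hs : s ∈ Set.Icc ((l : ℝ) * T / m) (((l : ℝ) + 1) * T / m)) :
    L1Le P (fun ω => Y s ω - eulerLangevin T α k y₀ m (fun t => W t ω) (l + 1))
      (langevinIncrementConst T α k y₀ * √(T / m) * Real.exp (α * T)) := by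
  have hm : 1 ≤ m := by omega
  have hm0 : (0 : ℝ) < m := by exact_mod_cast hm
  have h0 := grid_mem_Icc hT hl.le
  have h1 := grid_mem_Icc hT (Nat.succ_le_of_lt hl)
  have hh : 0 ≤ T / m := by positivity
  have hhT : T / m ≤ T := div_le_self hT (by exact_mod_cast hm)
  have hlen : ((l : ℝ) + 1) * T / m - (l : ℝ) * T / m = T / m := by ring
  have he := l1Le_langevin_sub_euler hT hα hk hY hW hW0 hinc heq hm (Nat.succ_le_of_lt hl)
  rw [Nat.cast_succ] at h1 he
  have hd := l1Le_langevin_sub hT hα hk hY hW hW0 hinc heq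
    (s := s) ⟨h0.1.trans hs.1, hs.2.trans h1.2⟩ h1 hs.2 (h := T / m) (by linarith [hs.1]) hhT
  refine ((hd.abs.add he.abs).of_abs_le ?_ (Filter.Eventually.of_forall fun ω => ?_)).mono ?_
  · exact ((hY.measurable _).sub (measurable_eulerLangevin hW m (l + 1))).aestronglyMeasurable
  · rw [abs_sub_comm (Y _ ω) (Y s ω)]
    exact abs_sub_le _ _ _
  · have hpow : (1 + α * (T / m)) ^ (l + 1) ≤ Real.exp (α * T) := by
      calc (1 + α * (T / m)) ^ (l + 1) ≤ (1 + α * (T / m)) ^ m :=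
            pow_le_pow_right₀ (by linarith [mul_nonneg hα.le hh]) hl
        _ ≤ Real.exp (α * (T / m)) ^ m := by
            gcongr
            linarith [Real.add_one_le_exp (α * (T / m))]
        _ = Real.exp (α * T) := by
            rw [← Real.exp_nat_mul]
            congr 1
            field_simp
    have hK := langevinIncrementConst_pos (y₀ := y₀) hT hα hk
    calc _ = langevinIncrementConst T α k y₀ * √(T / m) * (1 + α * (T / m)) ^ (l + 1) := by
          rw [Nat.succ_eq_add_one]; ring
      _ ≤ _ := by gcongr

lemma measurable_avgVolatility_sub {σ : ℝ → ℝ} (hT : 0 ≤ T) (hσ : Continuous fun x => σ x ^ 2)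
    (hY : IsContProcess Y) (hW : IsContProcess W) (m : ℕ) :
    Measurable fun ω => avgVolatility T σ (fun s => Y s ω) -
      avgVolatilityDiscrete m σ (eulerLangevin T α k y₀ m (fun t => W t ω)) := by
  refine Measurable.sub ?_ ?_
  · exact (((hY.comp hσ).measurable_integral hT).const_mul _).sqrt
  · refine (Measurable.const_mul (Finset.measurable_sum _ fun l _ => ?_) _).sqrt
    exact hσ.measurable.comp (measurable_eulerLangevin hW m l)

/-- Choosing the tangent point `D` equal to the bound for `𝔼|Y_s - Y^{(m)}_l|` plays the role of
Jensen's inequality for `x ↦ x ^ γ`. -/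
lemma l1Le_avgVolatility_sub [IsProbabilityMeasure P] {c L γ : ℝ} {σ : ℝ → ℝ} (hT : 0 < T)
    (hα : 0 < α) (hk : 0 < k) (hc : 0 < c) (hL : 0 < L) (hγ₀ : 0 < γ) (hγ₁ : γ ≤ 1)
    (hσ : ∀ x, c ≤ σ x) (hH : ∀ x y, |σ x ^ 2 - σ y ^ 2| ≤ L * |x - y| ^ γ)
    (hY : IsContProcess Y) (hW : IsContProcess W) (hW0 : ∀ ω, W 0 ω = 0)
    (hinc : ∀ s ∈ Set.Icc 0 T, ∀ t ∈ Set.Icc 0 T, s ≤ t →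
      L1Le P (fun ω => W t ω - W s ω) √(t - s))
    (heq : ∀ᵐ ω ∂P, ∀ t ∈ Set.Icc 0 T,
      Y t ω = y₀ - α * (∫ s in (0 : ℝ)..t, Y s ω) + k * W t ω)
    {m : ℕ} (hm : 1 ≤ m) :
    L1Le P (fun ω => avgVolatility T σ (fun s => Y s ω) -
        avgVolatilityDiscrete m σ (eulerLangevin T α k y₀ m (fun t => W t ω)))
      ((2 * c)⁻¹ * L *
        (langevinIncrementConst T α k y₀ * √(T / m) * Real.exp (α * T)) ^ γ) := by
  have hm0 : (0 : ℝ) < m := by exact_mod_cast hm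
  have hK := langevinIncrementConst_pos (y₀ := y₀) hT.le hα hk
  have hD : 0 < langevinIncrementConst T α k y₀ * √(T / m) * Real.exp (α * T) := by positivity
  have hcell : ∀ l ∈ Finset.range m, L1Le P
      (fun ω => ∫ s in ((l : ℝ) * T / m)..(((l : ℝ) + 1) * T / m),
        |Y s ω - eulerLangevin T α k y₀ m (fun t => W t ω) (l + 1)|)
      (T / m * (langevinIncrementConst T α k y₀ * √(T / m) * Real.exp (α * T))) := by
    intro l hl
    have hlen : ((l : ℝ) + 1) * T / m - (l : ℝ) * T / m = T / m := by ring
    have h := (hY.sub (measurable_eulerLangevin (T := T) (α := α) (k := k) (y₀ := y₀) hW m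
      (l + 1))).l1Le_integral_abs (P := P)
      (a := (l : ℝ) * T / m) (b := ((l : ℝ) + 1) * T / m) (by gcongr; linarith) fun s hs =>
      l1Le_langevin_sub_euler_cell hT.le hα hk hY hW hW0 hinc heq (Finset.mem_range.1 hl) hs
    rwa [hlen] at h
  set D := langevinIncrementConst T α k y₀ * √(T / m) * Real.exp (α * T) with hDdef
  have hsum := (L1Le.sum fun l hl => ((hcell l hl).const_mul
    (by positivity : 0 ≤ L * (D ^ γ * γ / D))).add
      (L1Le.const (P := P) (L * (D ^ γ * (1 - γ)) * (T / m)))).const_mul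
        (by positivity : 0 ≤ (2 * c * T)⁻¹)
  refine (hsum.of_abs_le ?_ (Filter.Eventually.of_forall fun ω => ?_)).mono (le_of_eq ?_)
  · exact (measurable_avgVolatility_sub hT.le (continuous_of_abs_sub_le_rpow hγ₀ hH)
      hY hW m).aestronglyMeasurable
  · exact abs_avgVolatility_sub_le_affine hT hc hL hγ₀ hγ₁ hD hm hσ hH (hY.continuous ω)
  · rw [Finset.sum_const, Finset.card_range, nsmul_eq_mul, abs_of_nonneg
      (mul_nonneg (mul_nonneg hL.le (mul_nonneg (by positivity) (sub_nonneg.2 hγ₁)))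
        (by positivity))]
    field_simp
    ring

end Moments

/-! ### Convergence of the averaged volatility -/

theorem mainTheorem2 (T α k y₀ c L γ : ℝ) (hT : 0 < T) (hα : 0 < α) (hk : 0 < k)
    (hc : 0 < c) (hL : 0 < L) (hγ₀ : 0 < γ) (hγ₁ : γ ≤ 1) :
    ∃ C : ℝ, 0 < C ∧
      ∀ (σ : ℝ → ℝ), (∀ x, c ≤ σ x) →
        (∀ x y, |σ x ^ 2 - σ y ^ 2| ≤ L * |x - y| ^ γ) →
      ∀ {Ω : Type*} [MeasurableSpace Ω] (P : Measure Ω) [IsProbabilityMeasure P]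
        (Z Y : ℝ → Ω → ℝ), IsWienerOn T Z P → IsLangevinSolution T α k y₀ Z Y P →
      ∀ m : ℕ, 1 ≤ m →
        Integrable (fun ω => |avgVolatility T σ (fun s => Y s ω) -
          avgVolatilityDiscrete m σ (eulerLangevin T α k y₀ m (fun t => Z t ω))|) P ∧
        ∫ ω, |avgVolatility T σ (fun s => Y s ω) -
          avgVolatilityDiscrete m σ (eulerLangevin T α k y₀ m (fun t => Z t ω))| ∂P
          ≤ C * (m : ℝ) ^ (-(γ / 2)) := by
  have hK := langevinIncrementConst_pos (y₀ := y₀) hT.le hα hk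
  refine ⟨(2 * c)⁻¹ * L * (langevinIncrementConst T α k y₀ * √T * Real.exp (α * T)) ^ γ,
    by positivity, ?_⟩
  intro σ hσ hH Ω _ P _ Z Y hZ hY m hm
  have hm0 : (0 : ℝ) < m := by exact_mod_cast hm
  obtain ⟨Z', hZ', hZZ'⟩ := exists_isContProcess_ae_eq hT.le hZ.aemeasurable hZ.continuous_paths
  obtain ⟨Y', hY', hYY'⟩ := exists_isContProcess_ae_eq hT.le hY.aemeasurable hY.continuous_paths
  have hT0 : (0 : ℝ) ∈ Set.Icc 0 T := ⟨le_rfl, hT.le⟩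
  -- `Z' t - Z' 0` drives the same equation and the same scheme, and vanishes at `0` surely.
  have hW := hZ'.sub (hZ'.measurable 0)
  have hinc : ∀ s ∈ Set.Icc 0 T, ∀ t ∈ Set.Icc 0 T, s ≤ t →
      L1Le P (fun ω => (Z' t ω - Z' 0 ω) - (Z' s ω - Z' 0 ω)) √(t - s) := by
    intro s hs t ht hst
    have h := ((hZ.gaussian_increments s hs t ht hst).congr
      (Y := fun ω => (Z' t ω - Z' 0 ω) - (Z' s ω - Z' 0 ω)) (by
        filter_upwards [hZZ'] with ω hω
        rw [hω s hs, hω t ht]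
        ring)).l1Le_of_gaussianReal
    rwa [Real.coe_toNNReal _ (sub_nonneg.2 hst)] at h
  have heq : ∀ᵐ ω ∂P, ∀ t ∈ Set.Icc 0 T,
      Y' t ω = y₀ - α * (∫ s in (0 : ℝ)..t, Y' s ω) + k * (Z' t ω - Z' 0 ω) := by
    filter_upwards [hY.equation, hYY', hZZ'] with ω h1 h2 h3 t ht
    have hi : ∫ s in (0 : ℝ)..t, Y s ω = ∫ s in (0 : ℝ)..t, Y' s ω := by
      refine intervalIntegral.integral_congr fun s hs => ?_
      rw [Set.uIcc_of_le ht.1] at hs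
      exact h2 s ⟨hs.1, hs.2.trans ht.2⟩
    rw [← h2 t ht, ← h3 t ht, ← h3 0 hT0, ← hi]
    exact h1 t ht
  have hmain := l1Le_avgVolatility_sub hT hα hk hc hL hγ₀ hγ₁ hσ hH hY' hW (by simp)
    hinc heq hm
  have hae : (fun ω => |avgVolatility T σ (fun s => Y s ω) -
      avgVolatilityDiscrete m σ (eulerLangevin T α k y₀ m (fun t => Z t ω))|) =ᵐ[P]
      fun ω => |avgVolatility T σ (fun s => Y' s ω) -
        avgVolatilityDiscrete m σ (eulerLangevin T α k y₀ m (fun t => Z' t ω - Z' 0 ω))| := by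
    filter_upwards [hYY', hZZ'] with ω h2 h3
    have hi : avgVolatility T σ (fun s => Y s ω) = avgVolatility T σ (fun s => Y' s ω) := by
      unfold avgVolatility
      congr 2
      refine intervalIntegral.integral_congr fun s hs => ?_
      rw [Set.uIcc_of_le hT.le] at hs
      simp only [h2 s hs]
    have hd : avgVolatilityDiscrete m σ (eulerLangevin T α k y₀ m (fun t => Z t ω)) =
        avgVolatilityDiscrete m σ (eulerLangevin T α k y₀ m (fun t => Z' t ω - Z' 0 ω)) := by
      unfold avgVolatilityDiscrete
      congr 2
      refine Finset.sum_congr rfl fun l hl => ?_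
      rw [eulerLangevin_congr hT.le (w := fun t => Z' t ω - Z' 0 ω) (fun s hs t ht => by
        rw [h3 s hs, h3 t ht]; ring) (Finset.mem_Icc.1 hl).2]
    rw [hi, hd]
  refine ⟨(integrable_congr hae).2 hmain.integrable.abs, ?_⟩
  rw [integral_congr_ae hae]
  refine hmain.bound.trans_eq ?_
  have hsq : √(T / m) = √T * (m : ℝ) ^ (-(1 / 2) : ℝ) := by
    rw [Real.sqrt_div hT.le, Real.rpow_neg hm0.le, ← Real.sqrt_eq_rpow, div_eq_mul_inv]
  have hD : langevinIncrementConst T α k y₀ * √(T / m) * Real.exp (α * T) =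
      langevinIncrementConst T α k y₀ * √T * Real.exp (α * T) * (m : ℝ) ^ (-(1 / 2) : ℝ) := by
    rw [hsq]
    ring
  rw [hD, Real.mul_rpow (by positivity) (by positivity), ← Real.rpow_mul hm0.le,
    show (-(1 / 2) : ℝ) * γ = -(γ / 2) by ring]
  ring
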